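/- Let $\phi:\mathcal X\to\mathbb R^d$ be a representation, $\mathcal D=(x_1,\dots,x_N)$ a finite dataset in $\mathcal X$ with $\|\phi(x_n)\|_2\le 1$ for all $n$, $\sigma:\mathbb R\to[-1,1]$ an odd function, $\theta\in\mathbb R^d$ with $\theta\neq 0$, and let $\tau_\theta(x)=\sigma(\theta^T\phi(x))$. For $w\in\mathbb R^d$ put $\mathcal L_\theta(w)=\sum_{n=1}^N\exp(-\tau_\theta(x_n)\,w^T\phi(x_n))$. Given $w_0\in\mathbb R^d$ and $\eta>0$, let $w_{m+1}=w_m-\eta\nabla\mathcal L_\theta(w_m)$ be the gradient descent iterates, and let $\mathcal L_M^{\mathrm{binary}}(\theta)=\mathcal L_\theta(w_M)$. Call the labeling $\tau_\theta$ linearly separable if some $w\in\mathbb R^d$ satisfies $\tau_\theta(x_n)\,w^T\phi(x_n)>0$ for all $n$. (a) If $\sigma(t)>0$ for all $t>0$ (e.g. $\sigma=\tanh$) and $\theta^T\phi(x_n)\ne 0$ for all $n$, then $\tau_\theta$ is linearly separable. (b) Suppose $\tau_\theta$ is linearly separable. Then the hard-margin SVM problem $$\min_{w}\ \|w\|_2^2\quad\text{s.t.}\quad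 \tau_\theta(x_n)\,w^T\phi(x_n)\ge 1\ \ \text{for all } n$$ has a unique solution $w_{\mathrm{SVM}}(\theta)$. Let $S_\theta=\{n:\tau_\theta(x_n)\,w_{\mathrm{SVM}}(\theta)^T\phi(x_n)=1\}$. Suppose moreover that the dataset is non-degenerate: the vectors $\phi(x_n)$, $n\in S_\theta$, span the same subspace as all the $\phi(x_n)$, and the dual problem $$\max_{\alpha\ge 0}\ \sum_n\alpha_n-\tfrac12\sum_{i,j}\alpha_i\alpha_j\tau_\theta(x_i)\tau_\theta(x_j)\,\phi(x_i)^T\phi(x_j)$$ has a solution with $\alpha_n>0$ for $n\in S_\theta$ and $\alpha_n=0$ for $n\notin S_\theta$. Then for every $w_0\in\mathbb R^d$ and every step size $0<\eta<1/\mathcal L_\theta(w_0)$ there are a dual solution $\alpha$ and a vector $\tilde w(\theta)\in\mathbb R^d$ with $\eta\exp(-\tau_\theta(x_n)\,\tilde w(\theta)^T\phi(x_n))=\alpha_n$ for all $n\in S_\theta$, such that the residuals $r_M(\theta)$ defined by $$w_M=w_{\mathrm{SVM}}(\theta)\log M+\tilde w(\theta)+r_M(\theta)\qquad(M\ge1)$$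 are bounded, $\lim_{M\to\infty}\|r_M(\theta)\|_2=0$, and for every $M\ge 1$ $$\mathcal L_M^{\mathrm{binary}}(\theta)\ \ge\ \bigl(M\eta\exp(\|r_M(\theta)\|_2)\bigr)^{-1}\,\|w_{\mathrm{SVM}}(\theta)\|_2^2 .$$ -/

import Mathlib

noncomputable section

namespace GenObjective

variable {X : Type*} {d N : ℕ}

/-- The linear task encoder `τ_θ(x) = σ(θᵀ φ(x))`. -/
def taskEncoder (σ : ℝ → ℝ) (φ : X → EuclideanSpace ℝ (Fin d))
    (θ : EuclideanSpace ℝ (Fin d)) (a : X) : ℝ :=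
  σ (inner ℝ θ (φ a))

/-- The exponential loss on the dataset `x₁, …, x_N` of the linear model `wᵀ φ(·)` with respect
to the labeling `τ`. -/
def expLoss (φ : X → EuclideanSpace ℝ (Fin d)) (x : Fin N → X) (τ : X → ℝ)
    (w : EuclideanSpace ℝ (Fin d)) : ℝ :=
  ∑ n, Real.exp (-(τ (x n) * inner ℝ w (φ (x n))))

/-- One step of gradient descent on the exponential loss with step size `η`. -/
def gdStep (φ : X → EuclideanSpace ℝ (Fin d)) (x : Fin N → X) (τ : X → ℝ) (η : ℝ)
    (w : EuclideanSpace ℝ (Fin d)) : EuclideanSpace ℝ (Fin d) :=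
  w - η • gradient (expLoss φ x τ) w

/-- The iterate `w_M` after `M` steps of gradient descent started at `w₀`. -/
def gdIterate (φ : X → EuclideanSpace ℝ (Fin d)) (x : Fin N → X) (τ : X → ℝ) (η : ℝ)
    (w₀ : EuclideanSpace ℝ (Fin d)) (M : ℕ) : EuclideanSpace ℝ (Fin d) :=
  (gdStep φ x τ η)^[M] w₀

/-- The generalization-based objective `L_M^binary(θ)`: the exponential loss, with respect to the
labeling `τ_θ`, of the linear model trained by `M` gradient descent steps on that labeling. -/
def binaryObjective (φ : X → EuclideanSpace ℝ (Fin d)) (x : Fin N → X) (σ : ℝ → ℝ) (η : ℝ)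
    (w₀ : EuclideanSpace ℝ (Fin d)) (M : ℕ) (θ : EuclideanSpace ℝ (Fin d)) : ℝ :=
  expLoss φ x (taskEncoder σ φ θ) (gdIterate φ x (taskEncoder σ φ θ) η w₀ M)

/-- Some linear model without bias has a positive margin on every data point. -/
def LinearlySeparable (φ : X → EuclideanSpace ℝ (Fin d)) (x : Fin N → X) (τ : X → ℝ) : Prop :=
  ∃ w : EuclideanSpace ℝ (Fin d), ∀ n, 0 < τ (x n) * inner ℝ w (φ (x n))

/-- The feasible set of the hard-margin SVM. -/
def svmFeasible (φ : X → EuclideanSpace ℝ (Fin d)) (x : Fin N → X) (τ : X → ℝ) :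
    Set (EuclideanSpace ℝ (Fin d)) :=
  {w | ∀ n, 1 ≤ τ (x n) * inner ℝ w (φ (x n))}

/-- `w` solves the (primal) hard-margin SVM problem. -/
def IsHardMarginSVM (φ : X → EuclideanSpace ℝ (Fin d)) (x : Fin N → X) (τ : X → ℝ)
    (w : EuclideanSpace ℝ (Fin d)) : Prop :=
  w ∈ svmFeasible φ x τ ∧ IsMinOn (fun v => ‖v‖ ^ 2) (svmFeasible φ x τ) w

/-- The hard-margin SVM solution `w_SVM` (meaningful when the problem has a solution). -/
def wSVM (φ : X → EuclideanSpace ℝ (Fin d)) (x : Fin N → X) (τ : X → ℝ) :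
    EuclideanSpace ℝ (Fin d) :=
  Classical.epsilon (IsHardMarginSVM φ x τ)

/-- The objective of the dual hard-margin SVM problem. -/
def svmDualObjective (φ : X → EuclideanSpace ℝ (Fin d)) (x : Fin N → X) (τ : X → ℝ)
    (α : Fin N → ℝ) : ℝ :=
  ∑ n, α n -
    (1 / 2) * ∑ i, ∑ j, α i * α j * τ (x i) * τ (x j) * inner ℝ (φ (x i)) (φ (x j))

/-- `α` solves the dual hard-margin SVM problem. -/
def IsDualSVM (φ : X → EuclideanSpace ℝ (Fin d)) (x : Fin N → X) (τ : X → ℝ)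
    (α : Fin N → ℝ) : Prop :=
  (∀ n, 0 ≤ α n) ∧ IsMaxOn (svmDualObjective φ x τ) {β | ∀ n, 0 ≤ β n} α

/-- The indices of the support vectors. -/
def supportIdx (φ : X → EuclideanSpace ℝ (Fin d)) (x : Fin N → X) (τ : X → ℝ) : Set (Fin N) :=
  {n | τ (x n) * inner ℝ (wSVM φ x τ) (φ (x n)) = 1}

/-- The dataset is non-degenerate for the labeling `τ`: the support vectors span the data, and
some dual solution is strictly positive exactly at the support vectors. -/
def NonDegenerate (φ : X → EuclideanSpace ℝ (Fin d)) (x : Fin N → X) (τ : X → ℝ) : Prop :=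
  Submodule.span ℝ ((fun n => φ (x n)) '' supportIdx φ x τ) =
      Submodule.span ℝ (Set.range fun n => φ (x n)) ∧
    ∃ α : Fin N → ℝ, IsDualSVM φ x τ α ∧
      (∀ n ∈ supportIdx φ x τ, 0 < α n) ∧ ∀ n ∉ supportIdx φ x τ, α n = 0

end GenObjective

end

/-!
By strict complementarity the hard-margin solution `ŵ` is a positive combination of the support
vectors, and minimising a coercive convex function rebalances it: there is an offset `w̃` with
`ŵ = ∑ n, α n • z n`, where `α n = η * exp (-⟪w̃, z n⟫)` on the support vectors. Along the path
`log m • ŵ + w̃` a gradient step then agrees with the increment of the path up to a summable error: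
a support vector contributes `(α n / m) • z n`, any other vector `O(m ^ (-q))` with `q > 1`.

The residual `u` of gradient descent from this path satisfies, up to summable errors (including the
squared step lengths, which are summable because the loss decreases),
`‖u (m + 1)‖ ^ 2 ≤ ‖u m‖ ^ 2 - 2 * (log (m + 1) - log m) * D (u m)`, where `D` is continuous and
positive away from `0` on the span of the support vectors. Hence `‖u m‖` converges, and its limit
is `0` because `∑ (log (m + 1) - log m)` diverges. At time `M` a support vector has loss at least
`α n * exp (-‖u M‖) / (M * η)`, and `∑ n, α n = ‖ŵ‖ ^ 2` gives the lower bound.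
-/

namespace GenObjective

open Filter Topology
open scoped RealInnerProductSpace

theorem one_sub_exp_neg_mul_self_pos {t : ℝ} (ht : t ≠ 0) : 0 < (1 - Real.exp (-t)) * t := by
  rcases ht.lt_or_gt with ht | ht
  · exact mul_pos_of_neg_of_neg (sub_neg.2 (Real.one_lt_exp_iff.2 (neg_pos.2 ht))) ht
  · exact mul_pos (sub_pos.2 (Real.exp_lt_one_iff.2 (neg_lt_zero.2 ht))) ht

theorem exp_neg_mul_self_le_one (t : ℝ) : Real.exp (-t) * t ≤ 1 :=
  calc Real.exp (-t) * t = t * Real.exp (-t) := mul_comm _ _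
    _ ≤ Real.exp (-1) := Real.mul_exp_neg_le_exp_neg_one t
    _ ≤ 1 := Real.exp_le_one_iff.2 (by norm_num)

theorem mul_abs_sub_le_mul_exp_neg_add {a : ℝ} (ha : 0 < a) (b t : ℝ) :
    b * |t| - 2 * b ^ 2 / a ≤ a * Real.exp (-t) + b * t := by
  rcases le_total 0 t with ht | ht
  · rw [abs_of_nonneg ht]
    have : 0 ≤ 2 * b ^ 2 / a := by positivity
    have : 0 < a * Real.exp (-t) := by positivity
    linarith
  · rw [abs_of_nonpos ht]
    have hexp : a * (t ^ 2 / 2) ≤ a * Real.exp (-t) := by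
      gcongr
      linarith [Real.quadratic_le_exp_of_nonneg (neg_nonneg.2 ht), neg_sq t]
    have hsquare : a * (t ^ 2 / 2) + 2 * b * t + 2 * b ^ 2 / a =
        (a * t + 2 * b) ^ 2 / (2 * a) := by
      field_simp
      ring
    have : 0 ≤ (a * t + 2 * b) ^ 2 / (2 * a) := by positivity
    linarith

theorem nonpos_of_forall_mul_le_sq_mul {a q s : ℝ} (hs : 0 < s)
    (h : ∀ t, 0 < t → t ≤ s → t * a ≤ t ^ 2 * q) : a ≤ 0 := by
  have hlim : Tendsto (fun t : ℝ => t * q) (𝓝[>] 0) (𝓝 0) := by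
    simpa using (tendsto_id.mul_const q).mono_left (nhdsWithin_le_nhds (a := (0 : ℝ)))
  refine ge_of_tendsto hlim ?_
  filter_upwards [Ioc_mem_nhdsGT hs] with t ht
  refine le_of_mul_le_mul_left ?_ ht.1
  linarith [h t ht.1 ht.2]

theorem log_add_one_sub_log_nonneg (m : ℕ) : 0 ≤ Real.log (m + 1) - Real.log m := by
  rcases m.eq_zero_or_pos with rfl | hm
  · simp
  · exact sub_nonneg.2 (Real.log_le_log (by exact_mod_cast hm) (by linarith))

theorem log_add_one_sub_log_le {p : ℝ} (hp : 0 < p) :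
    Real.log (p + 1) - Real.log p ≤ 1 / p := by
  rw [← Real.log_div (by positivity) hp.ne']
  refine (Real.log_le_sub_one_of_pos (by positivity)).trans_eq ?_
  field_simp
  ring

theorem one_div_sub_log_add_one_sub_log_le {p : ℝ} (hp : 0 < p) :
    1 / p - (Real.log (p + 1) - Real.log p) ≤ 1 / p ^ 2 := by
  rw [← Real.log_div (by positivity) hp.ne']
  calc 1 / p - Real.log ((p + 1) / p) ≤ 1 / p - (1 - ((p + 1) / p)⁻¹) := by
        gcongr
        exact Real.one_sub_inv_le_log_of_pos (by positivity)
    _ = 1 / (p ^ 2 + p) := by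
        field_simp
        ring
    _ ≤ 1 / p ^ 2 := one_div_le_one_div_of_le (by positivity) (by linarith)

theorem not_summable_log_add_one_sub_log :
    ¬Summable fun m : ℕ => Real.log (m + 1) - Real.log m := by
  rw [not_summable_iff_tendsto_nat_atTop_of_nonneg log_add_one_sub_log_nonneg]
  have htelescope (M : ℕ) :
      ∑ m ∈ Finset.range M, (Real.log (m + 1) - Real.log m) = Real.log M := by
    simpa using Finset.sum_range_sub (fun m : ℕ => Real.log m) M
  simp only [htelescope]
  exact Real.tendsto_log_atTop.comp tendsto_natCast_atTop_atTop

theorem summable_sq_log_add_one_sub_log :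
    Summable fun m : ℕ => (Real.log (m + 1) - Real.log m) ^ 2 := by
  refine (Real.summable_one_div_nat_pow.2 one_lt_two).of_norm_bounded_eventually_nat ?_
  filter_upwards [eventually_gt_atTop 0] with m hm
  rw [Real.norm_of_nonneg (sq_nonneg _), ← one_div_pow]
  exact pow_le_pow_left₀ (log_add_one_sub_log_nonneg m)
    (log_add_one_sub_log_le (by exact_mod_cast hm)) 2

/-- A deterministic form of the Robbins–Siegmund lemma. -/
theorem exists_tendsto_and_summable_of_le_add_sub {a c s : ℕ → ℝ} (ha : ∀ m, 0 ≤ a m)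
    (hs : ∀ m, 0 ≤ s m) (hc : Summable c) (h : ∀ m, a (m + 1) ≤ a m + c m - s m) :
    (∃ l, Tendsto a atTop (𝓝 l)) ∧ Summable s := by
  set C : ℕ → ℝ := fun m => ∑ k ∈ Finset.range m, c k
  have hC : Tendsto C atTop (𝓝 (∑' k, c k)) := hc.hasSum.tendsto_sum_nat
  obtain ⟨B, hB⟩ := hC.bddAbove_range
  have hCB (m : ℕ) : C m ≤ B := hB ⟨m, rfl⟩
  have hstep (m : ℕ) : a (m + 1) - C (m + 1) ≤ a m - C m - s m := by
    simp only [C, Finset.sum_range_succ]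
    linarith [h m]
  constructor
  · have hanti : Antitone fun m => a m - C m :=
      antitone_nat_of_succ_le fun m => (hstep m).trans (sub_le_self _ (hs m))
    have hbdd : BddBelow (Set.range fun m => a m - C m) :=
      ⟨-B, by rintro _ ⟨m, rfl⟩; dsimp only; linarith [ha m, hCB m]⟩
    have hlim := (tendsto_atTop_ciInf hanti hbdd).add hC
    simp only [sub_add_cancel] at hlim
    exact ⟨_, hlim⟩
  · refine summable_of_sum_range_le (c := a 0 - C 0 + B) hs fun m => ?_
    calc ∑ k ∈ Finset.range m, s k
        ≤ ∑ k ∈ Finset.range m, ((a k - C k) - (a (k + 1) - C (k + 1))) :=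
          Finset.sum_le_sum fun k _ => by linarith [hstep k]
      _ = a 0 - C 0 - (a m - C m) := Finset.sum_range_sub' _ _
      _ ≤ a 0 - C 0 + B := by linarith [ha m, hCB m]

theorem tendsto_zero_of_dissipation {E : Type*} [NormedAddCommGroup E] [ProperSpace E]
    {D : E → ℝ} (hDc : Continuous D) (hD : ∀ v, 0 ≤ D v) (hDpos : ∀ v, v ≠ 0 → 0 < D v)
    {u : ℕ → E} {c δ : ℕ → ℝ} (hc : Summable c) (hδ : ∀ m, 0 ≤ δ m) (hδs : ¬Summable δ)
    (h : ∀ m, ‖u (m + 1)‖ ^ 2 ≤ ‖u m‖ ^ 2 + c m - δ m * D (u m)) :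
    Tendsto u atTop (𝓝 0) := by
  obtain ⟨⟨l, hl⟩, hsum⟩ := exists_tendsto_and_summable_of_le_add_sub
    (fun m => sq_nonneg ‖u m‖) (fun m => mul_nonneg (hδ m) (hD (u m))) hc h
  suffices hl0 : l = 0 by
    rw [tendsto_zero_iff_norm_tendsto_zero]
    simpa [hl0] using hl.sqrt
  by_contra hne
  have hlpos : 0 < l := (ge_of_tendsto' hl fun m => sq_nonneg _).lt_of_ne' hne
  -- On the compact annulus `l / 2 ≤ ‖v‖ ^ 2 ≤ l + 1`, which `u` eventually never leaves, the
  -- dissipation is bounded below, so its weighted sum would dominate the divergent sum of `δ`.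
  have hcompact : IsCompact {v : E | ‖v‖ ^ 2 ∈ Set.Icc (l / 2) (l + 1)} :=
    (isCompact_closedBall (0 : E) √(l + 1)).of_isClosed_subset
      (isClosed_Icc.preimage (by fun_prop)) fun v hv =>
        mem_closedBall_zero_iff.2 (Real.le_sqrt_of_sq_le hv.2)
  obtain ⟨κ, hκ, hκD⟩ := hcompact.exists_forall_le' hDc.continuousOn (a := 0) fun v hv =>
    hDpos v fun hv0 => by
      have := hv.1
      simp only [hv0, norm_zero] at this
      linarith
  refine hδs ((hsum.mul_left κ⁻¹).of_norm_bounded_eventually_nat ?_)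
  filter_upwards [hl.eventually_const_le (half_lt_self hlpos),
    hl.eventually_le_const (lt_add_one l)] with m hm₁ hm₂
  rw [Real.norm_of_nonneg (hδ m), ← div_eq_inv_mul, le_div_iff₀ hκ]
  exact mul_le_mul_of_nonneg_left (hκD _ ⟨hm₁, hm₂⟩) (hδ m)

section ExponentialLoss

variable {E ι : Type*} [NormedAddCommGroup E] [InnerProductSpace ℝ E] [Fintype ι] {z : ι → E}

/-- The exponential loss of the linear model `w` on the vectors `z n`, which stand for the features
multiplied by their labels, so that `⟪w, z n⟫` is the margin of the `n`-th data point. -/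
noncomputable def marginLoss (z : ι → E) (w : E) : ℝ :=
  ∑ n, Real.exp (-⟪w, z n⟫)

/-- The negative gradient of `marginLoss z`. -/
noncomputable def descentDirection (z : ι → E) (w : E) : E :=
  ∑ n, Real.exp (-⟪w, z n⟫) • z n

theorem hasFDerivAt_inner_left (y w : E) : HasFDerivAt (fun v => ⟪v, y⟫) (innerSL ℝ y) w :=
  (innerSL ℝ y).hasFDerivAt.congr_of_eventuallyEq (.of_forall fun v => real_inner_comm y v)

theorem hasFDerivAt_exp_neg_inner (y w : E) :
    HasFDerivAt (fun v => Real.exp (-⟪v, y⟫)) (-innerSL ℝ (Real.exp (-⟪w, y⟫) • y)) w := by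
  simpa only [map_smul, smul_neg] using (hasFDerivAt_inner_left y w).fun_neg.exp

theorem hasGradientAt_marginLoss [CompleteSpace E] (w : E) :
    HasGradientAt (marginLoss z) (-descentDirection z w) w := by
  have hsum := HasFDerivAt.fun_sum (u := Finset.univ) fun n _ => hasFDerivAt_exp_neg_inner (z n) w
  rw [Finset.sum_neg_distrib, ← map_sum, ← map_neg] at hsum
  exact hsum

theorem marginLoss_nonneg (w : E) : 0 ≤ marginLoss z w :=
  Finset.sum_nonneg fun _ _ => (Real.exp_pos _).le

theorem norm_descentDirection_le (hz : ∀ n, ‖z n‖ ≤ 1) (w : E) :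
    ‖descentDirection z w‖ ≤ marginLoss z w := by
  refine norm_sum_le_of_le _ fun n _ => ?_
  rw [norm_smul, Real.norm_of_nonneg (Real.exp_pos _).le]
  exact mul_le_of_le_one_right (Real.exp_pos _).le (hz n)

theorem sum_exp_mul_inner_descentDirection (w : E) :
    ∑ n, Real.exp (-⟪w, z n⟫) * ⟪descentDirection z w, z n⟫ = ‖descentDirection z w‖ ^ 2 := by
  conv_rhs => rw [← real_inner_self_eq_norm_sq, descentDirection, inner_sum]
  simp only [inner_smul_right, descentDirection]

theorem marginLoss_add_smul_descentDirection_le (hz : ∀ n, ‖z n‖ ≤ 1) {η : ℝ} (hη : 0 ≤ η) {w : E}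
    (hηw : η * marginLoss z w ≤ 1) :
    marginLoss z (w + η • descentDirection z w) ≤
      marginLoss z w - η * (1 - η * marginLoss z w) * ‖descentDirection z w‖ ^ 2 := by
  set g := descentDirection z w
  have hgz (n : ι) : |⟪g, z n⟫| ≤ ‖g‖ :=
    (abs_real_inner_le_norm _ _).trans (mul_le_of_le_one_right (norm_nonneg _) (hz n))
  have hsmall (n : ι) : |-(η * ⟪g, z n⟫)| ≤ 1 := by
    rw [abs_neg, abs_mul, abs_of_nonneg hη]
    calc η * |⟪g, z n⟫| ≤ η * marginLoss z w := by
          gcongr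
          exact (hgz n).trans (norm_descentDirection_le hz w)
      _ ≤ 1 := hηw
  have hexp (n : ι) : Real.exp (-(η * ⟪g, z n⟫)) ≤ 1 - η * ⟪g, z n⟫ + η ^ 2 * ‖g‖ ^ 2 := by
    have hquad := (abs_le.1 (Real.abs_exp_sub_one_sub_id_le (hsmall n))).2
    have hsq : ⟪g, z n⟫ ^ 2 ≤ ‖g‖ ^ 2 := sq_le_sq.2 (by simpa only [abs_norm] using hgz n)
    linarith [mul_le_mul_of_nonneg_left hsq (sq_nonneg η)]
  calc marginLoss z (w + η • g)
      = ∑ n, Real.exp (-⟪w, z n⟫) * Real.exp (-(η * ⟪g, z n⟫)) := by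
        simp only [marginLoss, inner_add_left, real_inner_smul_left, neg_add, Real.exp_add]
    _ ≤ ∑ n, Real.exp (-⟪w, z n⟫) * (1 - η * ⟪g, z n⟫ + η ^ 2 * ‖g‖ ^ 2) := by
        gcongr with n
        exact hexp n
    _ = marginLoss z w - η * ∑ n, Real.exp (-⟪w, z n⟫) * ⟪g, z n⟫
          + marginLoss z w * (η ^ 2 * ‖g‖ ^ 2) := by
        rw [marginLoss, Finset.mul_sum, Finset.sum_mul, ← Finset.sum_sub_distrib,
          ← Finset.sum_add_distrib]
        exact Finset.sum_congr rfl fun n _ => by ring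
    _ = marginLoss z w - η * (1 - η * marginLoss z w) * ‖g‖ ^ 2 := by
        rw [sum_exp_mul_inner_descentDirection]
        ring

section GradientDescent

variable {η : ℝ} {w : ℕ → E}

theorem marginLoss_gd_le (hz : ∀ n, ‖z n‖ ≤ 1) (hη : 0 ≤ η)
    (hw : ∀ m, w (m + 1) = w m + η • descentDirection z (w m))
    (hη₀ : η * marginLoss z (w 0) ≤ 1) (m : ℕ) : marginLoss z (w m) ≤ marginLoss z (w 0) := by
  induction m with
  | zero => rfl
  | succ m ih =>
    have hm : η * marginLoss z (w m) ≤ 1 := (mul_le_mul_of_nonneg_left ih hη).trans hη₀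
    rw [hw]
    refine (marginLoss_add_smul_descentDirection_le hz hη hm).trans ((sub_le_self _ ?_).trans ih)
    exact mul_nonneg (mul_nonneg hη (sub_nonneg.2 hm)) (sq_nonneg _)

theorem summable_norm_sq_gd_step (hz : ∀ n, ‖z n‖ ≤ 1) (hη : 0 ≤ η)
    (hw : ∀ m, w (m + 1) = w m + η • descentDirection z (w m))
    (hη₀ : η * marginLoss z (w 0) < 1) :
    Summable fun m => ‖η • descentDirection z (w m)‖ ^ 2 := by
  have hρ : 0 < 1 - η * marginLoss z (w 0) := sub_pos.2 hη₀
  have hstep (m : ℕ) : (1 - η * marginLoss z (w 0)) * ‖η • descentDirection z (w m)‖ ^ 2 ≤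
      η * (marginLoss z (w m) - marginLoss z (w (m + 1))) := by
    have hle : η * marginLoss z (w m) ≤ η * marginLoss z (w 0) :=
      mul_le_mul_of_nonneg_left (marginLoss_gd_le hz hη hw hη₀.le m) hη
    have hdescent := marginLoss_add_smul_descentDirection_le hz hη (hle.trans hη₀.le)
    rw [← hw] at hdescent
    calc (1 - η * marginLoss z (w 0)) * ‖η • descentDirection z (w m)‖ ^ 2
        = η * (η * (1 - η * marginLoss z (w 0)) * ‖descentDirection z (w m)‖ ^ 2) := by
          rw [norm_smul, Real.norm_of_nonneg hη]
          ring
      _ ≤ η * (η * (1 - η * marginLoss z (w m)) * ‖descentDirection z (w m)‖ ^ 2) := by gcongr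
      _ ≤ η * (marginLoss z (w m) - marginLoss z (w (m + 1))) := by
          gcongr
          linarith
  refine (summable_mul_left_iff hρ.ne').1 (summable_of_sum_range_le
    (c := η * marginLoss z (w 0)) (fun m => mul_nonneg hρ.le (sq_nonneg _)) fun m => ?_)
  refine (Finset.sum_le_sum fun k _ => hstep k).trans ?_
  rw [← Finset.mul_sum, Finset.sum_range_sub']
  exact mul_le_mul_of_nonneg_left (sub_le_self _ (marginLoss_nonneg _)) hη

theorem gd_sub_mem {V : Submodule ℝ E} (hzV : ∀ n, z n ∈ V)
    (hw : ∀ m, w (m + 1) = w m + η • descentDirection z (w m)) {y : E} (h₀ : w 0 - y ∈ V)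
    (m : ℕ) : w m - y ∈ V := by
  induction m with
  | zero => exact h₀
  | succ m ih =>
    rw [hw, add_sub_right_comm]
    exact V.add_mem ih (V.smul_mem _ (V.sum_mem fun n _ => V.smul_mem _ (hzV n)))

end GradientDescent

section Balancing

theorem eq_zero_of_mem_span_of_inner_eq_zero {s : Set E} {v : E} (hv : v ∈ Submodule.span ℝ s)
    (h : ∀ y ∈ s, ⟪v, y⟫ = 0) : v = 0 := by
  have hspan : Submodule.span ℝ s ≤ (innerSL ℝ v).ker := Submodule.span_le.2 h
  exact inner_self_eq_zero.1 (hspan hv)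

theorem exists_pos_mul_norm_le_sum_mul_abs_inner (z : ι → E) {b : ι → ℝ} (hb : ∀ n, 0 < b n) :
    ∃ κ : ℝ, 0 < κ ∧
      ∀ v : Submodule.span ℝ (Set.range z), κ * ‖v‖ ≤ ∑ n, b n * |⟪(v : E), z n⟫| := by
  have := FiniteDimensional.span_of_finite ℝ (Set.finite_range z)
  let A : Submodule.span ℝ (Set.range z) →ₗ[ℝ] (ι → ℝ) :=
    LinearMap.pi fun n => b n • (innerₛₗ ℝ (z n)) ∘ₗ (Submodule.span ℝ (Set.range z)).subtype
  have hA (v n) : A v n = b n * ⟪(v : E), z n⟫ := by simp [A, real_inner_comm]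
  have hker : A.ker = ⊥ := LinearMap.ker_eq_bot'.2 fun v hv => by
    refine Subtype.ext (eq_zero_of_mem_span_of_inner_eq_zero v.2 ?_)
    rintro _ ⟨n, rfl⟩
    have hn := congrFun hv n
    rw [hA] at hn
    exact (mul_eq_zero.1 hn).resolve_left (hb n).ne'
  obtain ⟨K, hK, hAK⟩ := A.exists_antilipschitzWith hker
  have hK' : (0 : ℝ) < K := by exact_mod_cast hK
  refine ⟨(K : ℝ)⁻¹, inv_pos.2 hK', fun v => (inv_mul_le_iff₀ hK').2 ?_⟩
  refine (hAK.le_mul_norm (map_zero A) v).trans ?_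
  gcongr
  have hnorm (n : ι) : ‖A v n‖ = b n * |⟪(v : E), z n⟫| := by
    rw [hA, Real.norm_eq_abs, abs_mul, abs_of_pos (hb n)]
  have hnonneg (n : ι) : 0 ≤ b n * |⟪(v : E), z n⟫| := mul_nonneg (hb n).le (abs_nonneg _)
  refine (pi_norm_le_iff_of_nonneg (Finset.sum_nonneg fun n _ => hnonneg n)).2 fun n => ?_
  rw [hnorm]
  exact Finset.single_le_sum (fun k _ => hnonneg k) (Finset.mem_univ n)

theorem tendsto_sum_mul_exp_neg_add_cocompact (z : ι → E) {a b : ι → ℝ} (ha : ∀ n, 0 < a n)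
    (hb : ∀ n, 0 < b n) :
    Tendsto (fun v : Submodule.span ℝ (Set.range z) =>
        ∑ n, (a n * Real.exp (-⟪(v : E), z n⟫) + b n * ⟪(v : E), z n⟫))
      (cocompact _) atTop := by
  have := FiniteDimensional.span_of_finite ℝ (Set.finite_range z)
  obtain ⟨κ, hκ, hκle⟩ := exists_pos_mul_norm_le_sum_mul_abs_inner z hb
  have hlower (v : Submodule.span ℝ (Set.range z)) : κ * ‖v‖ - ∑ n, 2 * b n ^ 2 / a n ≤
      ∑ n, (a n * Real.exp (-⟪(v : E), z n⟫) + b n * ⟪(v : E), z n⟫) := by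
    refine (sub_le_sub_right (hκle v) _).trans ?_
    rw [← Finset.sum_sub_distrib]
    exact Finset.sum_le_sum fun n _ => mul_abs_sub_le_mul_exp_neg_add (ha n) (b n) _
  refine tendsto_atTop_mono hlower (tendsto_atTop_add_const_right _ _ ?_)
  exact tendsto_norm_cocompact_atTop.const_mul_atTop hκ

theorem exists_sum_mul_exp_smul_eq (z : ι → E) {a b : ι → ℝ} (ha : ∀ n, 0 < a n)
    (hb : ∀ n, 0 < b n) :
    ∃ v ∈ Submodule.span ℝ (Set.range z),
      ∑ n, (a n * Real.exp (-⟪v, z n⟫)) • z n = ∑ n, b n • z n := by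
  set V := Submodule.span ℝ (Set.range z)
  -- The equation is the stationarity condition of the coercive function `f` on `V`.
  let f : E → ℝ := fun v => ∑ n, (a n * Real.exp (-⟪v, z n⟫) + b n * ⟪v, z n⟫)
  have hf : Continuous f := by fun_prop
  obtain ⟨v, hv⟩ : ∃ v : V, ∀ y : V, f v ≤ f y :=
    (hf.comp continuous_subtype_val).exists_forall_le
      (tendsto_sum_mul_exp_neg_add_cocompact z ha hb)
  refine ⟨v, v.2, (sub_eq_zero.1 ?_).symm⟩
  set g := ∑ n, b n • z n - ∑ n, (a n * Real.exp (-⟪(v : E), z n⟫)) • z n with hg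
  have hsum_mem (c : ι → ℝ) : ∑ n, c n • z n ∈ V :=
    V.sum_mem fun n _ => V.smul_mem _ (Submodule.subset_span ⟨n, rfl⟩)
  have hgV : g ∈ V := V.sub_mem (hsum_mem _) (hsum_mem _)
  have hderiv : HasFDerivAt f (innerSL ℝ g) (v : E) := by
    have hsum := HasFDerivAt.fun_sum (u := Finset.univ) fun n _ =>
      ((hasFDerivAt_exp_neg_inner (z n) (v : E)).const_mul (a n)).fun_add
        ((hasFDerivAt_inner_left (z n) (v : E)).const_mul (b n))
    refine hsum.congr_fderiv ?_
    simp only [hg, map_sub, map_sum, map_smul, mul_smul, smul_neg, Finset.sum_add_distrib,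
      Finset.sum_neg_distrib]
    abel
  have hstationary := IsLocalMin.hasFDerivAt_eq_zero (f := f ∘ V.subtypeL)
    (Eventually.of_forall hv) (hderiv.comp v V.subtypeL.hasFDerivAt)
  exact inner_self_eq_zero.1 (DFunLike.congr_fun hstationary ⟨g, hgV⟩)

end Balancing

end ExponentialLoss

section HardMargin

variable {E ι : Type*} [NormedAddCommGroup E] [InnerProductSpace ℝ E] {z : ι → E}

theorem convex_setOf_one_le_inner : Convex ℝ {w : E | ∀ n, 1 ≤ ⟪w, z n⟫} := by
  rw [Set.ofPred_forall]
  exact convex_iInter fun n => convex_halfSpace_ge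
    ⟨fun v w => inner_add_left v w (z n), fun c w => real_inner_smul_left w (z n) c⟩ 1

theorem isClosed_setOf_one_le_inner : IsClosed {w : E | ∀ n, 1 ≤ ⟪w, z n⟫} := by
  rw [Set.ofPred_forall]
  exact isClosed_iInter fun n => isClosed_le continuous_const (by fun_prop)

theorem existsUnique_isMinOn_norm_sq [CompleteSpace E] {K : Set E} (hK : K.Nonempty)
    (hclosed : IsClosed K) (hconv : Convex ℝ K) :
    ∃! w, w ∈ K ∧ IsMinOn (fun v => ‖v‖ ^ 2) K w := by
  obtain ⟨w, hwK, hw⟩ := exists_norm_eq_iInf_of_complete_convex hK hclosed.isComplete hconv 0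
  have hpythagoras (v : E) (hv : v ∈ K) : ‖w‖ ^ 2 + ‖v - w‖ ^ 2 ≤ ‖v‖ ^ 2 := by
    have hinner := (norm_eq_iInf_iff_real_inner_le_zero hconv hwK).1 hw v hv
    rw [zero_sub, inner_neg_left] at hinner
    have hexpand := norm_add_sq_real w (v - w)
    rw [add_sub_cancel] at hexpand
    linarith
  refine ⟨w, ⟨hwK, fun v hv => ?_⟩, ?_⟩
  · exact (le_add_of_nonneg_right (sq_nonneg _)).trans (hpythagoras v hv)
  · rintro v ⟨hvK, hv⟩
    have hle : ‖v‖ ^ 2 ≤ ‖w‖ ^ 2 := hv hwK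
    have hzero : ‖v - w‖ ^ 2 = 0 := le_antisymm (by linarith [hpythagoras v hvK]) (sq_nonneg _)
    exact sub_eq_zero.1 (norm_eq_zero.1 (eq_zero_of_pow_eq_zero hzero))

variable [Fintype ι]

/-- The objective of the Lagrange dual of minimising `‖w‖ ^ 2 / 2` subject to `1 ≤ ⟪w, z n⟫` for
all `n`. -/
noncomputable def dualValue (z : ι → E) (α : ι → ℝ) : ℝ :=
  ∑ n, α n - 1 / 2 * ‖∑ n, α n • z n‖ ^ 2

/-- The Karush–Kuhn–Tucker conditions, for multipliers `α`, of minimising `‖w‖ ^ 2 / 2` subject to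
`1 ≤ ⟪w, z n⟫` for all `n`. -/
structure IsKKT (z : ι → E) (α : ι → ℝ) (w : E) : Prop where
  nonneg (n : ι) : 0 ≤ α n
  feasible (n : ι) : 1 ≤ ⟪w, z n⟫
  stationary : w = ∑ n, α n • z n
  slack (n : ι) : α n * ⟪w, z n⟫ = α n

theorem dualValue_le_half_norm_sq {β : ι → ℝ} (hβ : ∀ n, 0 ≤ β n) {w : E}
    (hw : ∀ n, 1 ≤ ⟪w, z n⟫) : dualValue z β ≤ ‖w‖ ^ 2 / 2 := by
  have hsum : ∑ n, β n ≤ ⟪w, ∑ n, β n • z n⟫ := by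
    rw [inner_sum]
    refine Finset.sum_le_sum fun n _ => ?_
    rw [inner_smul_right]
    exact le_mul_of_one_le_right (hβ n) (hw n)
  rw [dualValue]
  linarith [norm_sub_sq_real w (∑ n, β n • z n), sq_nonneg ‖w - ∑ n, β n • z n‖]

theorem dualValue_add_single [DecidableEq ι] (α : ι → ℝ) (n : ι) (t : ℝ) :
    dualValue z (α + Pi.single n t) =
      dualValue z α + t * (1 - ⟪∑ k, α k • z k, z n⟫) - t ^ 2 * (‖z n‖ ^ 2 / 2) := by
  have hvec : ∑ k, (α + Pi.single n t : ι → ℝ) k • z k = ∑ k, α k • z k + t • z n := by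
    simp [add_smul, Finset.sum_add_distrib, Pi.single_apply, ite_smul]
  have hsum : ∑ k, (α + Pi.single n t : ι → ℝ) k = ∑ k, α k + t := by simp [Finset.sum_add_distrib]
  rw [dualValue, dualValue, hvec, hsum, norm_add_sq_real, inner_smul_right, norm_smul, mul_pow,
    Real.norm_eq_abs, sq_abs]
  ring

namespace IsKKT

variable {α : ι → ℝ} {w : E}

theorem sum_eq_norm_sq (h : IsKKT z α w) : ∑ n, α n = ‖w‖ ^ 2 :=
  calc ∑ n, α n = ∑ n, ⟪w, α n • z n⟫ := by simp only [inner_smul_right, h.slack]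
    _ = ⟪w, w⟫ := by rw [← inner_sum, ← h.stationary]
    _ = ‖w‖ ^ 2 := real_inner_self_eq_norm_sq w

theorem dualValue_eq (h : IsKKT z α w) : dualValue z α = ‖w‖ ^ 2 / 2 := by
  rw [dualValue, ← h.stationary, h.sum_eq_norm_sq]
  ring

theorem isMinOn_norm_sq (h : IsKKT z α w) :
    IsMinOn (fun v => ‖v‖ ^ 2) {v : E | ∀ n, 1 ≤ ⟪v, z n⟫} w := fun v hv => by
  have hweak := dualValue_le_half_norm_sq h.nonneg hv
  rw [h.dualValue_eq] at hweak
  exact (div_le_div_iff_of_pos_right two_pos).1 hweak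

theorem isMaxOn_dualValue (h : IsKKT z α w) :
    IsMaxOn (dualValue z) {β | ∀ n, 0 ≤ β n} α := fun _ hβ =>
  (dualValue_le_half_norm_sq hβ h.feasible).trans_eq h.dualValue_eq.symm

theorem eq_zero_of_inner_ne_one (h : IsKKT z α w) {n : ι} (hn : ⟪w, z n⟫ ≠ 1) : α n = 0 := by
  by_contra hα
  exact hn (mul_left_cancel₀ hα ((h.slack n).trans (mul_one _).symm))

end IsKKT

theorem isKKT_of_isMaxOn_dualValue {α : ι → ℝ} (hα : ∀ n, 0 ≤ α n)
    (hmax : IsMaxOn (dualValue z) {β | ∀ n, 0 ≤ β n} α) : IsKKT z α (∑ n, α n • z n) := by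
  classical
  set w := ∑ n, α n • z n
  have hperturb (n : ι) (t : ℝ) (ht : 0 ≤ α n + t) :
      t * (1 - ⟪w, z n⟫) ≤ t ^ 2 * (‖z n‖ ^ 2 / 2) := by
    have hnonneg : ∀ k, 0 ≤ (α + Pi.single n t : ι → ℝ) k := fun k => by
      rcases eq_or_ne k n with rfl | hk
      · simpa using ht
      · simpa [hk] using hα k
    have hle : dualValue z (α + Pi.single n t) ≤ dualValue z α := hmax hnonneg
    rw [dualValue_add_single] at hle
    linarith
  have hfeasible (n : ι) : 1 ≤ ⟪w, z n⟫ :=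
    sub_nonpos.1 (nonpos_of_forall_mul_le_sq_mul one_pos fun t ht _ =>
      hperturb n t (add_nonneg (hα n) ht.le))
  refine ⟨hα, hfeasible, rfl, fun n => ?_⟩
  rcases (hα n).eq_or_lt with hzero | hpos
  · rw [← hzero, zero_mul]
  · have hle : ⟪w, z n⟫ - 1 ≤ 0 := nonpos_of_forall_mul_le_sq_mul hpos fun t _ ht => by
      have := hperturb n (-t) (by linarith)
      rwa [neg_sq, neg_mul, ← mul_neg, neg_sub] at this
    rw [le_antisymm (sub_nonpos.1 hle) (hfeasible n), mul_one]

/-- The offset `wt` is chosen so that each support vector contributes `(α n / m) • z n` to a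
gradient step taken at `log m • w + wt`: up to the other data points, the step is `(1 / m) • w`. -/
theorem IsKKT.exists_mul_exp_eq {β : ι → ℝ} {w : E} (h : IsKKT z β w)
    (hβ : ∀ n, ⟪w, z n⟫ = 1 → 0 < β n) {η : ℝ} (hη : 0 < η) (w₀ : E) :
    ∃ (α : ι → ℝ) (wt : E), IsKKT z α w ∧
      (∀ n, ⟪w, z n⟫ = 1 → η * Real.exp (-⟪wt, z n⟫) = α n) ∧
      w₀ - wt ∈ Submodule.span ℝ (Set.range z) := by
  classical
  have hrestrict (γ : ι → ℝ) (hγ : ∀ n, ⟪w, z n⟫ ≠ 1 → γ n = 0) :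
      ∑ n : {n // ⟪w, z n⟫ = 1}, γ n • z n = ∑ n, γ n • z n :=
    Fintype.sum_of_injective _ Subtype.val_injective _ _
      (fun n hn => by rw [hγ n (by simpa using hn), zero_smul]) fun _ => rfl
  obtain ⟨v, hv, hbalance⟩ := exists_sum_mul_exp_smul_eq (fun n : {n // ⟪w, z n⟫ = 1} => z n)
    (a := fun n => η * Real.exp (-⟪w₀, z n⟫)) (b := fun n => β n) (fun n => by positivity)
    fun n => hβ n n.2
  let α : ι → ℝ := fun n => if ⟪w, z n⟫ = 1 then η * Real.exp (-⟪w₀ + v, z n⟫) else 0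
  have hα (n : ι) (hn : ⟪w, z n⟫ = 1) : α n = η * Real.exp (-⟪w₀ + v, z n⟫) := if_pos hn
  have hα₀ (n : ι) (hn : ⟪w, z n⟫ ≠ 1) : α n = 0 := if_neg hn
  refine ⟨α, w₀ + v, ⟨fun n => ?_, h.feasible, ?_, fun n => ?_⟩, fun n hn => (hα n hn).symm, ?_⟩
  · positivity
  · rw [← hrestrict α hα₀]
    calc w = ∑ n : {n // ⟪w, z n⟫ = 1}, β n • z n := by
          rw [hrestrict β fun n => h.eq_zero_of_inner_ne_one, ← h.stationary]
      _ = ∑ n : {n // ⟪w, z n⟫ = 1}, α n • z n := by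
          rw [← hbalance]
          refine Finset.sum_congr rfl fun n _ => ?_
          rw [hα n n.2, inner_add_left, neg_add, Real.exp_add, mul_assoc]
  · by_cases hn : ⟪w, z n⟫ = 1
    · rw [hn, mul_one]
    · rw [hα₀ n hn, zero_mul]
  · rw [sub_add_cancel_left]
    have hsub : Set.range (fun n : {n // ⟪w, z n⟫ = 1} => z n) ⊆ Set.range z := by
      rintro _ ⟨n, rfl⟩
      exact ⟨n, rfl⟩
    exact Submodule.neg_mem _ (Submodule.span_mono hsub hv)

end HardMargin

section Residual

variable {E ι : Type*} [NormedAddCommGroup E] [InnerProductSpace ℝ E] {z : ι → E}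
  {α : ι → ℝ} {w wt : E} {η : ℝ}

theorem exp_neg_inner_log_smul_add {p : ℝ} (hp : 0 < p) (w wt y : E) :
    Real.exp (-⟪Real.log p • w + wt, y⟫) = p ^ (-⟪w, y⟫) * Real.exp (-⟪wt, y⟫) := by
  rw [inner_add_left, real_inner_smul_left, neg_add, Real.exp_add, Real.rpow_def_of_pos hp,
    mul_neg]

theorem mul_exp_neg_inner_log_smul_add_eq_div
    (hwt : ∀ n, ⟪w, z n⟫ = 1 → η * Real.exp (-⟪wt, z n⟫) = α n) {n : ι} (hn : ⟪w, z n⟫ = 1)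
    {p : ℝ} (hp : 0 < p) : η * Real.exp (-⟪Real.log p • w + wt, z n⟫) = α n / p := by
  rw [exp_neg_inner_log_smul_add hp, hn, Real.rpow_neg_one, ← hwt n hn]
  field_simp

variable [Fintype ι]

/-- The rate, per unit of `log m`, at which gradient descent decreases half the squared distance to
its asymptotic path when it is displaced from that path by `v`. -/
noncomputable def dissipation (z : ι → E) (α : ι → ℝ) (v : E) : ℝ :=
  ∑ n, α n * ((1 - Real.exp (-⟪v, z n⟫)) * ⟪v, z n⟫)

theorem continuous_dissipation : Continuous (dissipation z α) := by
  unfold dissipation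
  fun_prop

theorem mul_one_sub_exp_neg_mul_self_nonneg {a : ℝ} (ha : 0 ≤ a) (t : ℝ) :
    0 ≤ a * ((1 - Real.exp (-t)) * t) := by
  rcases eq_or_ne t 0 with rfl | ht
  · simp
  · exact mul_nonneg ha (one_sub_exp_neg_mul_self_pos ht).le

theorem dissipation_nonneg (hα : ∀ n, 0 ≤ α n) (v : E) : 0 ≤ dissipation z α v :=
  Finset.sum_nonneg fun n _ => mul_one_sub_exp_neg_mul_self_nonneg (hα n) _

theorem dissipation_pos (hα : ∀ n, 0 ≤ α n) {v : E}
    (hv : v ∈ Submodule.span ℝ (z '' {n | 0 < α n})) (hv₀ : v ≠ 0) : 0 < dissipation z α v := by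
  obtain ⟨n, hn, hvn⟩ : ∃ n, 0 < α n ∧ ⟪v, z n⟫ ≠ 0 := by
    by_contra! h
    exact hv₀ (eq_zero_of_mem_span_of_inner_eq_zero hv (Set.forall_mem_image.2 h))
  exact Finset.sum_pos' (fun k _ => mul_one_sub_exp_neg_mul_self_nonneg (hα k) _)
    ⟨n, Finset.mem_univ n, mul_pos hn (one_sub_exp_neg_mul_self_pos hvn)⟩

theorem inner_sum_mul_exp_smul_sub_le {b : ι → ℝ} {δ : ℝ} (hb : ∀ n, δ * α n ≤ b n) (u : E) :
    ⟪u, ∑ n, (b n * Real.exp (-⟪u, z n⟫)) • z n - δ • ∑ n, α n • z n⟫ ≤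
      ∑ n, (b n - δ * α n) - δ * dissipation z α u := by
  simp only [dissipation, inner_sub_right, inner_sum, inner_smul_right, Finset.mul_sum,
    ← Finset.sum_sub_distrib]
  refine Finset.sum_le_sum fun n _ => ?_
  linarith [mul_le_of_le_one_right (sub_nonneg.2 (hb n)) (exp_neg_mul_self_le_one ⟪u, z n⟫)]

theorem norm_add_sub_sq_le (u g v : E) :
    ‖u + (g - v)‖ ^ 2 ≤ ‖u‖ ^ 2 + 2 * ⟪u, g - v⟫ + 2 * ‖g‖ ^ 2 + 2 * ‖v‖ ^ 2 := by
  linarith [norm_add_sq_real u (g - v), parallelogram_law_with_norm ℝ g v,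
    mul_self_nonneg ‖g + v‖, pow_two ‖g‖, pow_two ‖v‖, pow_two ‖g - v‖]

theorem smul_descentDirection_add (η : ℝ) (y u : E) :
    η • descentDirection z (y + u) =
      ∑ n, (η * Real.exp (-⟪y, z n⟫) * Real.exp (-⟪u, z n⟫)) • z n := by
  simp only [descentDirection, Finset.smul_sum, smul_smul, inner_add_left, neg_add, Real.exp_add,
    mul_assoc]

theorem norm_sq_add_gd_step_sub_le {y u : E} {δ : ℝ} (hw : w = ∑ n, α n • z n)
    (hy : ∀ n, δ * α n ≤ η * Real.exp (-⟪y, z n⟫)) :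
    ‖u + (η • descentDirection z (y + u) - δ • w)‖ ^ 2 ≤ ‖u‖ ^ 2 +
      (2 * ∑ n, (η * Real.exp (-⟪y, z n⟫) - δ * α n) +
        2 * ‖η • descentDirection z (y + u)‖ ^ 2 + δ ^ 2 * (2 * ‖w‖ ^ 2)) -
      δ * (2 * dissipation z α u) := by
  have hinner := inner_sum_mul_exp_smul_sub_le (z := z) hy u
  rw [← smul_descentDirection_add, ← hw] at hinner
  have hexpand := norm_add_sub_sq_le u (η • descentDirection z (y + u)) (δ • w)
  rw [norm_smul δ, mul_pow, Real.norm_eq_abs, sq_abs] at hexpand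
  linarith

theorem log_add_one_sub_log_mul_le (h : IsKKT z α w) (hη : 0 ≤ η)
    (hwt : ∀ n, ⟪w, z n⟫ = 1 → η * Real.exp (-⟪wt, z n⟫) = α n) (m : ℕ) (n : ι) :
    (Real.log (m + 1) - Real.log m) * α n ≤
      η * Real.exp (-⟪Real.log m • w + wt, z n⟫) := by
  have hnonneg : 0 ≤ η * Real.exp (-⟪Real.log m • w + wt, z n⟫) := by positivity
  by_cases hn : ⟪w, z n⟫ = 1
  · rcases m.eq_zero_or_pos with rfl | hm
    · simpa using hnonneg
    · have hm' : (0 : ℝ) < m := by exact_mod_cast hm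
      rw [mul_exp_neg_inner_log_smul_add_eq_div hwt hn hm', div_eq_mul_one_div, mul_comm]
      exact mul_le_mul_of_nonneg_left (log_add_one_sub_log_le hm') (h.nonneg n)
  · rwa [h.eq_zero_of_inner_ne_one hn, mul_zero]

theorem summable_mul_exp_sub_log_add_one_sub_log_mul (h : IsKKT z α w)
    (hwt : ∀ n, ⟪w, z n⟫ = 1 → η * Real.exp (-⟪wt, z n⟫) = α n) (n : ι) :
    Summable fun m : ℕ => η * Real.exp (-⟪Real.log m • w + wt, z n⟫) -
      (Real.log (m + 1) - Real.log m) * α n := by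
  by_cases hn : ⟪w, z n⟫ = 1
  · refine ((Real.summable_one_div_nat_pow.2 one_lt_two).mul_left
      (α n)).of_norm_bounded_eventually_nat ?_
    filter_upwards [eventually_gt_atTop 0] with m hm
    have hm' : (0 : ℝ) < m := by exact_mod_cast hm
    rw [mul_exp_neg_inner_log_smul_add_eq_div hwt hn hm', div_eq_mul_one_div, mul_comm _ (α n),
      ← mul_sub, Real.norm_of_nonneg (mul_nonneg (h.nonneg n)
        (sub_nonneg.2 (log_add_one_sub_log_le hm')))]
    exact mul_le_mul_of_nonneg_left (one_div_sub_log_add_one_sub_log_le hm') (h.nonneg n)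
  · have hlt : -⟪w, z n⟫ < -1 := neg_lt_neg ((h.feasible n).lt_of_ne' hn)
    refine ((Real.summable_nat_rpow.2 hlt).mul_left
      (η * Real.exp (-⟪wt, z n⟫))).congr_atTop ?_
    filter_upwards [eventually_gt_atTop 0] with m hm
    rw [h.eq_zero_of_inner_ne_one hn, exp_neg_inner_log_smul_add (by exact_mod_cast hm)]
    ring

theorem exists_summable_norm_sq_gd_residual_succ_le {wgd : ℕ → E} (h : IsKKT z α w) (hη : 0 ≤ η)
    (hwt : ∀ n, ⟪w, z n⟫ = 1 → η * Real.exp (-⟪wt, z n⟫) = α n)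
    (hgd : ∀ m, wgd (m + 1) = wgd m + η • descentDirection z (wgd m))
    (hsum : Summable fun m => ‖η • descentDirection z (wgd m)‖ ^ 2) :
    -- The path starts at `wt`, with increment `0` at `m = 0`, because `Real.log 0 = 0`.
    ∃ c : ℕ → ℝ, Summable c ∧ ∀ m : ℕ,
      ‖wgd (m + 1) - (Real.log ↑(m + 1) • w + wt)‖ ^ 2 ≤
        ‖wgd m - (Real.log m • w + wt)‖ ^ 2 + c m -
          (Real.log (m + 1) - Real.log m) *
            (2 * dissipation z α (wgd m - (Real.log m • w + wt))) := by
  refine ⟨fun m =>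
    2 * ∑ n, (η * Real.exp (-⟪Real.log m • w + wt, z n⟫) -
      (Real.log (m + 1) - Real.log m) * α n) +
    2 * ‖η • descentDirection z (wgd m)‖ ^ 2 +
    (Real.log (m + 1) - Real.log m) ^ 2 * (2 * ‖w‖ ^ 2), ?_, fun m => ?_⟩
  · have hexcess := summable_sum fun n (_ : n ∈ Finset.univ) =>
      summable_mul_exp_sub_log_add_one_sub_log_mul h hwt n
    exact ((hexcess.mul_left 2).add (hsum.mul_left 2)).add
      (summable_sq_log_add_one_sub_log.mul_right _)
  · have hsucc : wgd (m + 1) - (Real.log ↑(m + 1) • w + wt) =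
        wgd m - (Real.log m • w + wt) +
          (η • descentDirection z (wgd m) - (Real.log (m + 1) - Real.log m) • w) := by
      rw [hgd, Nat.cast_succ, sub_smul]
      abel
    have hstep := norm_sq_add_gd_step_sub_le (u := wgd m - (Real.log m • w + wt)) h.stationary
      (log_add_one_sub_log_mul_le h hη hwt m)
    rw [hsucc]
    rwa [add_sub_cancel] at hstep

theorem tendsto_gd_residual {wgd : ℕ → E} (h : IsKKT z α w) (hη : 0 < η)
    (hwt : ∀ n, ⟪w, z n⟫ = 1 → η * Real.exp (-⟪wt, z n⟫) = α n)
    (hspan : Submodule.span ℝ (Set.range z) ≤ Submodule.span ℝ (z '' {n | ⟪w, z n⟫ = 1}))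
    (hgd : ∀ m, wgd (m + 1) = wgd m + η • descentDirection z (wgd m))
    (h₀ : wgd 0 - wt ∈ Submodule.span ℝ (Set.range z))
    (hsum : Summable fun m => ‖η • descentDirection z (wgd m)‖ ^ 2) :
    Tendsto (fun m : ℕ => wgd m - (Real.log m • w + wt)) atTop (𝓝 0) := by
  set V := Submodule.span ℝ (Set.range z)
  have : FiniteDimensional ℝ V := FiniteDimensional.span_of_finite ℝ (Set.finite_range z)
  have hzV (n : ι) : z n ∈ V := Submodule.subset_span ⟨n, rfl⟩
  have hwV : w ∈ V := h.stationary ▸ V.sum_mem fun n _ => V.smul_mem _ (hzV n)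
  have hresidual (m : ℕ) : wgd m - (Real.log m • w + wt) ∈ V := by
    rw [add_comm, ← sub_sub]
    exact V.sub_mem (gd_sub_mem hzV hgd h₀ m) (V.smul_mem _ hwV)
  let u (m : ℕ) : V := ⟨wgd m - (Real.log m • w + wt), hresidual m⟩
  have hsupport : {n | ⟪w, z n⟫ = 1} ⊆ {n | 0 < α n} := fun n hn =>
    (mul_pos hη (Real.exp_pos _)).trans_eq (hwt n hn)
  have hpos (v : V) (hv : v ≠ 0) : 0 < 2 * dissipation z α v :=
    mul_pos two_pos (dissipation_pos h.nonneg
      (Submodule.span_mono (Set.image_mono hsupport) (hspan v.2)) (by simpa using hv))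
  obtain ⟨c, hc, hstep⟩ := exists_summable_norm_sq_gd_residual_succ_le h hη.le hwt hgd hsum
  have hu : Tendsto u atTop (𝓝 0) := tendsto_zero_of_dissipation
    (D := fun v : V => 2 * dissipation z α v)
    ((continuous_dissipation.comp continuous_subtype_val).const_mul 2)
    (fun v => mul_nonneg two_pos.le (dissipation_nonneg h.nonneg _)) hpos hc
    log_add_one_sub_log_nonneg not_summable_log_add_one_sub_log hstep
  exact (continuous_subtype_val.tendsto (0 : V)).comp hu

theorem inv_mul_norm_sq_le_marginLoss (h : IsKKT z α w) (hz : ∀ n, ‖z n‖ ≤ 1) (hη : 0 < η)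
    (hwt : ∀ n, ⟪w, z n⟫ = 1 → η * Real.exp (-⟪wt, z n⟫) = α n) {p : ℝ} (hp : 0 < p) (u : E) :
    (p * η * Real.exp ‖u‖)⁻¹ * ‖w‖ ^ 2 ≤ marginLoss z (Real.log p • w + wt + u) := by
  rw [← h.sum_eq_norm_sq, marginLoss, Finset.mul_sum]
  refine Finset.sum_le_sum fun n _ => ?_
  by_cases hn : ⟪w, z n⟫ = 1
  · have hun : ⟪u, z n⟫ ≤ ‖u‖ := (real_inner_le_norm _ _).trans
      (mul_le_of_le_one_right (norm_nonneg _) (hz n))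
    calc (p * η * Real.exp ‖u‖)⁻¹ * α n
        = η⁻¹ * (α n / p) * Real.exp (-‖u‖) := by
          rw [Real.exp_neg ‖u‖]
          field_simp
      _ = Real.exp (-⟪Real.log p • w + wt, z n⟫) * Real.exp (-‖u‖) := by
          rw [← mul_exp_neg_inner_log_smul_add_eq_div hwt hn hp, inv_mul_cancel_left₀ hη.ne']
      _ ≤ Real.exp (-⟪Real.log p • w + wt, z n⟫) * Real.exp (-⟪u, z n⟫) := by gcongr
      _ = Real.exp (-⟪Real.log p • w + wt + u, z n⟫) := by
          rw [inner_add_left _ u, neg_add, Real.exp_add]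
  · rw [h.eq_zero_of_inner_ne_one hn, mul_zero]
    exact (Real.exp_pos _).le

end Residual

section Dataset

variable {X : Type*} {d N : ℕ} {φ : X → EuclideanSpace ℝ (Fin d)} {x : Fin N → X} {τ : X → ℝ}

/-- The features of the data points multiplied by their labels; the inner product of `w` with these
vectors gives the margins of the linear model `w`. -/
noncomputable def signedFeature (φ : X → EuclideanSpace ℝ (Fin d)) (x : Fin N → X) (τ : X → ℝ)
    (n : Fin N) : EuclideanSpace ℝ (Fin d) :=
  τ (x n) • φ (x n)

theorem inner_signedFeature (w : EuclideanSpace ℝ (Fin d)) (n : Fin N) :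
    ⟪w, signedFeature φ x τ n⟫ = τ (x n) * ⟪w, φ (x n)⟫ :=
  inner_smul_right _ _ _

theorem expLoss_eq_marginLoss : expLoss φ x τ = marginLoss (signedFeature φ x τ) := by
  funext w
  simp only [expLoss, marginLoss, inner_signedFeature]

theorem svmFeasible_eq : svmFeasible φ x τ = {w | ∀ n, 1 ≤ ⟪w, signedFeature φ x τ n⟫} := by
  simp only [svmFeasible, inner_signedFeature]

theorem supportIdx_eq :
    supportIdx φ x τ = {n | ⟪wSVM φ x τ, signedFeature φ x τ n⟫ = 1} := by
  simp only [supportIdx, inner_signedFeature]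

theorem svmDualObjective_eq_dualValue :
    svmDualObjective φ x τ = dualValue (signedFeature φ x τ) := by
  funext α
  rw [svmDualObjective, dualValue, ← real_inner_self_eq_norm_sq, sum_inner]
  simp only [inner_sum, signedFeature, inner_smul_right, real_inner_smul_left]
  congr! 4
  ring

theorem gdIterate_succ (η : ℝ) (w₀ : EuclideanSpace ℝ (Fin d)) (m : ℕ) :
    gdIterate φ x τ η w₀ (m + 1) = gdIterate φ x τ η w₀ m +
      η • descentDirection (signedFeature φ x τ) (gdIterate φ x τ η w₀ m) := by
  rw [gdIterate, Function.iterate_succ_apply', gdStep, expLoss_eq_marginLoss,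
    (hasGradientAt_marginLoss _).gradient, smul_neg, sub_neg_eq_add]
  rfl

theorem svmFeasible_nonempty (hsep : LinearlySeparable φ x τ) : (svmFeasible φ x τ).Nonempty := by
  obtain ⟨v, hv⟩ := hsep
  obtain ⟨ε, hε, hεv⟩ : ∃ ε : ℝ, 0 < ε ∧ ∀ n, ε ≤ τ (x n) * ⟪v, φ (x n)⟫ := by
    rcases isEmpty_or_nonempty (Fin N) with h | h
    · exact ⟨1, one_pos, fun n => h.elim n⟩
    · obtain ⟨k, hk⟩ := Finite.exists_min fun n => τ (x n) * ⟪v, φ (x n)⟫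
      exact ⟨_, hv k, hk⟩
  refine ⟨ε⁻¹ • v, fun n => ?_⟩
  rw [real_inner_smul_left, mul_left_comm, ← div_eq_inv_mul, one_le_div hε]
  exact hεv n

theorem isHardMarginSVM_iff_eq_wSVM (hsep : LinearlySeparable φ x τ)
    (w : EuclideanSpace ℝ (Fin d)) : IsHardMarginSVM φ x τ w ↔ w = wSVM φ x τ := by
  have huniq : ∃! w, IsHardMarginSVM φ x τ w :=
    existsUnique_isMinOn_norm_sq (svmFeasible_nonempty hsep)
      (svmFeasible_eq (φ := φ) ▸ isClosed_setOf_one_le_inner)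
      (svmFeasible_eq (φ := φ) ▸ convex_setOf_one_le_inner)
  have hspec : IsHardMarginSVM φ x τ (wSVM φ x τ) := Classical.epsilon_spec huniq.exists
  exact ⟨fun h => huniq.unique h hspec, fun h => h ▸ hspec⟩

theorem isDualSVM_iff_isKKT (hsep : LinearlySeparable φ x τ) {α : Fin N → ℝ} :
    IsDualSVM φ x τ α ↔ IsKKT (signedFeature φ x τ) α (wSVM φ x τ) := by
  rw [IsDualSVM, svmDualObjective_eq_dualValue]
  refine ⟨fun ⟨hα, hmax⟩ => ?_, fun h => ⟨h.nonneg, h.isMaxOn_dualValue⟩⟩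
  have hkkt := isKKT_of_isMaxOn_dualValue hα hmax
  have hprimal : IsHardMarginSVM φ x τ (∑ n, α n • signedFeature φ x τ n) := by
    rw [IsHardMarginSVM, svmFeasible_eq]
    exact ⟨hkkt.feasible, hkkt.isMinOn_norm_sq⟩
  rwa [(isHardMarginSVM_iff_eq_wSVM hsep _).1 hprimal] at hkkt

theorem span_range_signedFeature_le (hsep : LinearlySeparable φ x τ) {S : Set (Fin N)}
    (hspan : Submodule.span ℝ ((fun n => φ (x n)) '' S) =
      Submodule.span ℝ (Set.range fun n => φ (x n))) :
    Submodule.span ℝ (Set.range (signedFeature φ x τ)) ≤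
      Submodule.span ℝ (signedFeature φ x τ '' S) := by
  obtain ⟨v, hv⟩ := hsep
  calc Submodule.span ℝ (Set.range (signedFeature φ x τ))
      ≤ Submodule.span ℝ (Set.range fun n => φ (x n)) := by
        rw [Submodule.span_le]
        rintro _ ⟨n, rfl⟩
        exact Submodule.smul_mem _ _ (Submodule.subset_span ⟨n, rfl⟩)
    _ = Submodule.span ℝ ((fun n => φ (x n)) '' S) := hspan.symm
    _ ≤ Submodule.span ℝ (signedFeature φ x τ '' S) := by
        rw [Submodule.span_le]
        rintro _ ⟨n, hn, rfl⟩
        have hτ : τ (x n) ≠ 0 := left_ne_zero_of_mul (hv n).ne'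
        exact (Submodule.smul_mem_iff _ hτ).1 (Submodule.subset_span ⟨n, hn, rfl⟩)

theorem linearlySeparable_taskEncoder {σ : ℝ → ℝ} (hodd : Function.Odd σ)
    {θ : EuclideanSpace ℝ (Fin d)} (hpos : ∀ t, 0 < t → 0 < σ t) (hθ : ∀ n, ⟪θ, φ (x n)⟫ ≠ 0) :
    LinearlySeparable φ x (taskEncoder σ φ θ) := by
  refine ⟨θ, fun n => ?_⟩
  rw [taskEncoder]
  rcases (hθ n).lt_or_gt with hlt | hgt
  · have hneg := hpos _ (neg_pos.2 hlt)
    rw [hodd] at hneg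
    exact mul_pos_of_neg_of_neg (neg_pos.1 hneg) hlt
  · exact mul_pos (hpos _ hgt) hgt

theorem gdIterate_asymptotics (hz : ∀ n, ‖signedFeature φ x τ n‖ ≤ 1)
    (hsep : LinearlySeparable φ x τ) (hnd : NonDegenerate φ x τ)
    (w₀ : EuclideanSpace ℝ (Fin d)) {η : ℝ} (hη : 0 < η) (hηw₀ : η * expLoss φ x τ w₀ < 1) :
    ∃ (α : Fin N → ℝ) (wt : EuclideanSpace ℝ (Fin d)) (r : ℕ → EuclideanSpace ℝ (Fin d)),
      IsDualSVM φ x τ α ∧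
      (∀ n ∈ supportIdx φ x τ, η * Real.exp (-(τ (x n) * ⟪wt, φ (x n)⟫)) = α n) ∧
      (∀ M : ℕ, 1 ≤ M → gdIterate φ x τ η w₀ M = Real.log M • wSVM φ x τ + wt + r M) ∧
      (∃ C : ℝ, ∀ M, ‖r M‖ ≤ C) ∧
      Tendsto (fun M => ‖r M‖) atTop (𝓝 0) ∧
      ∀ M : ℕ, 1 ≤ M →
        ((M : ℝ) * η * Real.exp ‖r M‖)⁻¹ * ‖wSVM φ x τ‖ ^ 2 ≤
          expLoss φ x τ (gdIterate φ x τ η w₀ M) := by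
  obtain ⟨hspan, β, hβ, hβpos, -⟩ := hnd
  simp only [isDualSVM_iff_isKKT hsep, expLoss_eq_marginLoss, supportIdx_eq, Set.mem_ofPred_eq,
    ← inner_signedFeature] at hspan hβ hβpos hηw₀ ⊢
  obtain ⟨α, wt, hα, hwt, hw₀⟩ := hβ.exists_mul_exp_eq hβpos hη w₀
  set r : ℕ → EuclideanSpace ℝ (Fin d) := fun M =>
    gdIterate φ x τ η w₀ M - (Real.log M • wSVM φ x τ + wt)
  have hr (M : ℕ) : gdIterate φ x τ η w₀ M = Real.log M • wSVM φ x τ + wt + r M :=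
    (add_sub_cancel _ _).symm
  have hlim : Tendsto (fun M => ‖r M‖) atTop (𝓝 0) :=
    tendsto_zero_iff_norm_tendsto_zero.1 <| tendsto_gd_residual hα hη hwt
      (span_range_signedFeature_le hsep hspan) (gdIterate_succ η w₀) hw₀
      (summable_norm_sq_gd_step hz hη.le (gdIterate_succ η w₀) hηw₀)
  obtain ⟨C, hC⟩ := hlim.bddAbove_range
  refine ⟨α, wt, r, hα, hwt, fun M _ => hr M, ⟨C, fun M => hC ⟨M, rfl⟩⟩, hlim, fun M hM => ?_⟩
  rw [hr]
  exact inv_mul_norm_sq_le_marginLoss hα hz hη hwt (by exact_mod_cast hM) (r M)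

end Dataset

end GenObjective

theorem proposition3p1 {X : Type*} {d N : ℕ}
    (φ : X → EuclideanSpace ℝ (Fin d)) (x : Fin N → X) (hφ : ∀ n, ‖φ (x n)‖ ≤ 1)
    (σ : ℝ → ℝ) (hσ_odd : Function.Odd σ) (hσ_range : ∀ t, σ t ∈ Set.Icc (-1 : ℝ) 1)
    (θ : EuclideanSpace ℝ (Fin d)) (hθ : θ ≠ 0) :
    -- a sign-preserving activation produces linearly separable labelings
    ((∀ t, 0 < t → 0 < σ t) → (∀ n, inner ℝ θ (φ (x n)) ≠ 0) →
      GenObjective.LinearlySeparable φ x (GenObjective.taskEncoder σ φ θ)) ∧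
    (GenObjective.LinearlySeparable φ x (GenObjective.taskEncoder σ φ θ) →
      -- `wSVM` is the unique solution of the hard-margin SVM for the labeling
      (∀ w, GenObjective.IsHardMarginSVM φ x (GenObjective.taskEncoder σ φ θ) w ↔
        w = GenObjective.wSVM φ x (GenObjective.taskEncoder σ φ θ)) ∧
      (GenObjective.NonDegenerate φ x (GenObjective.taskEncoder σ φ θ) →
        ∀ (w₀ : EuclideanSpace ℝ (Fin d)) (η : ℝ), 0 < η →
          η < 1 / GenObjective.expLoss φ x (GenObjective.taskEncoder σ φ θ) w₀ →
          ∃ (α : Fin N → ℝ) (wt : EuclideanSpace ℝ (Fin d))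
            (r : ℕ → EuclideanSpace ℝ (Fin d)),
            GenObjective.IsDualSVM φ x (GenObjective.taskEncoder σ φ θ) α ∧
            (∀ n ∈ GenObjective.supportIdx φ x (GenObjective.taskEncoder σ φ θ),
              η * Real.exp (-(GenObjective.taskEncoder σ φ θ (x n) * inner ℝ wt (φ (x n)))) =
                α n) ∧
            -- `r M` is the residual of the gradient descent iterate `w_M`
            (∀ M : ℕ, 1 ≤ M →
              GenObjective.gdIterate φ x (GenObjective.taskEncoder σ φ θ) η w₀ M =
                Real.log M • GenObjective.wSVM φ x (GenObjective.taskEncoder σ φ θ) + wt + r M) ∧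
            (∃ C : ℝ, ∀ M, ‖r M‖ ≤ C) ∧
            Filter.Tendsto (fun M => ‖r M‖) Filter.atTop (nhds 0) ∧
            ∀ M : ℕ, 1 ≤ M →
              ((M : ℝ) * η * Real.exp ‖r M‖)⁻¹ *
                  ‖GenObjective.wSVM φ x (GenObjective.taskEncoder σ φ θ)‖ ^ 2 ≤
                GenObjective.binaryObjective φ x σ η w₀ M θ)) := by
  refine ⟨GenObjective.linearlySeparable_taskEncoder hσ_odd, fun hsep =>
    ⟨GenObjective.isHardMarginSVM_iff_eq_wSVM hsep, fun hnd w₀ η hη hη₁ => ?_⟩⟩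
  refine GenObjective.gdIterate_asymptotics (fun n => ?_) hsep hnd w₀ hη ?_
  · rw [GenObjective.signedFeature, norm_smul]
    exact mul_le_one₀ (abs_le.2 (hσ_range _)) (norm_nonneg _) (hφ n)
  · exact (lt_div_iff₀ (one_div_pos.1 (hη.trans hη₁))).1 hη₁
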